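/- Let $S$ be a monoid. Left and right $S$-acts are nonempty sets with an action of $S$. For a right $S$-act $A$ and a left $S$-act $B$, $A\otimes B$ is the quotient of $A\times B$ by the equivalence relation generated by the pairs $\big((as,b),(a,sb)\big)$, and $a\otimes b$ is the class of $(a,b)$. A *skeleton* is a sequence $\mathcal S=(s_1,t_1,\dots,s_m,t_m)\in S^{2m}$ with $m\ge 1$; $\mathbb S$ is the set of all skeletons. Elements $(a,b),(a',b')\in A\times B$ are *connected by a tossing over $A$ and $B$ with skeleton $\mathcal S$* if there are $a_2,\dots,a_m\in A$ and $b_1,\dots,b_m\in B$ such that, with $a_1=a$ and $a_{m+1}=a'$, $$a_is_i=a_{i+1}t_i\ (1\le i\le m),\qquad b=s_1b_1,\quad t_ib_i=s_{i+1}b_{i+1}\ (1\le i<m),\quad t_mb_m=b'.$$ Write $\delta_{\mathcal S}(a,a')$ for the statement that there are $a_2,\dots,a_m\in A$ satisfying the first group of equations. Let $\mathcal C$ be a class of embeddings (injective $S$-morphisms) of right $S$-acts; maps are written on the right. A left $S$-act $B$ is *$\mathcal C$-flat* if for every $\tau:A\to A'$ in $\mathcal C$ the map $A\otimes B\to A'\otimes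 B$, $a\otimes b\mapsto a\tau\otimes b$, is one-one. Let $\mathcal{CF}$ be the class of $\mathcal C$-flat left $S$-acts, regarded as structures for the first order language $L_S$ that has one unary function symbol for each $s\in S$ and no other symbols besides equality. It is *axiomatisable* if there is a set of sentences of $L_S$ whose models are exactly the members of $\mathcal{CF}$. Suppose that $\mathcal C$ satisfies *Condition (Free)*: for each $\mathcal S\in\mathbb S$ there are an embedding $\tau_{\mathcal S}:W_{\mathcal S}\to W'_{\mathcal S}$ in $\mathcal C$ and $u_{\mathcal S},u'_{\mathcal S}\in W_{\mathcal S}$ such that $\delta_{\mathcal S}(u_{\mathcal S}\tau_{\mathcal S},u'_{\mathcal S}\tau_{\mathcal S})$ holds in $W'_{\mathcal S}$ and, for every $\mu:A\to A'$ in $\mathcal C$ and all $a,a'\in A$ such that $\delta_{\mathcal S}(a\mu,a'\mu)$ holds in $A'$, there is an $S$-morphism $\nu:W'_{\mathcal S}\to A'$ with $u_{\mathcal S}\tau_{\mathcal S}\nu=a\mu$, $u'_{\mathcal S}\tau_{\mathcal S}\nu=a'\mu$ and $W_{\mathcal S}\tau_{\mathcal S}\nu\subseteq A\mu$. Fix any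 such choice of $\tau_{\mathcal S},u_{\mathcal S},u'_{\mathcal S}$ ($\mathcal S\in\mathbb S$). Then the following are equivalent: 1. $\mathcal{CF}$ is axiomatisable; 2. $\mathcal{CF}$ is closed under ultraproducts; 3. for every $\mathcal S\in\mathbb S$ there are finitely many skeletons $\mathcal S_1,\dots,\mathcal S_{\alpha(\mathcal S)}$ such that for every $\gamma:A\to A'$ in $\mathcal C$, every $\mathcal C$-flat left $S$-act $B$, all $a,a'\in A$ and all $b,b'\in B$: if $(a\gamma,b)$ and $(a'\gamma,b')$ are connected by a tossing over $A'$ and $B$ with skeleton $\mathcal S$, then $(a,b)$ and $(a',b')$ are connected by a tossing over $A$ and $B$ with skeleton $\mathcal S_k$ for some $k\in\{1,\dots,\alpha(\mathcal S)\}$; 4. for every $\mathcal S\in\mathbb S$ there are finitely many skeletons $\mathcal S_1,\dots,\mathcal S_{\beta(\mathcal S)}$ such that for every $\mathcal C$-flat left $S$-act $B$ and all $b,b'\in B$: if $(u_{\mathcal S}\tau_{\mathcal S},b)$ and $(u'_{\mathcal S}\tau_{\mathcal S},b')$ are connected by a tossing over $W'_{\mathcal S}$ and $B$ with skeleton $\mathcal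 S$, then $(u_{\mathcal S},b)$ and $(u'_{\mathcal S},b')$ are connected by a tossing over $W_{\mathcal S}$ and $B$ with skeleton $\mathcal S_k$ for some $k\in\{1,\dots,\beta(\mathcal S)\}$. -/

import Mathlib

/-! Acts over a monoid `S`.  A left `S`-act is a nonempty type with `MulAction S`; a right `S`-act
is a nonempty type with `MulAction Sᵐᵒᵖ`, and `a <• s` (that is, `MulOpposite.op s • a`) is the
element `a s`. -/

universe u

namespace SAct

open scoped RightActions
open scoped FirstOrder

/-- A skeleton `(s₁, t₁, …, sₘ, tₘ)`, of length `m = n + 1 ≥ 1`; the pair `(sᵢ₊₁, tᵢ₊₁)` of the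
usual numbering is `(s i, t i)` here. -/
structure Skeleton (S : Type u) : Type u where
  n : ℕ
  s : Fin (n + 1) → S
  t : Fin (n + 1) → S

/-- An embedding (injective `S`-morphism) `dom → cod` of right `S`-acts. Acts are nonempty
(nonemptiness of `cod` follows from that of `dom`). -/
structure RightActEmbedding (S : Type u) [Monoid S] : Type (u + 1) where
  dom : Type u
  cod : Type u
  [domAct : MulAction Sᵐᵒᵖ dom]
  [codAct : MulAction Sᵐᵒᵖ cod]
  [domNonempty : Nonempty dom]
  toHom : dom →[Sᵐᵒᵖ] cod
  injective : Function.Injective toHom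

attribute [instance] RightActEmbedding.domAct RightActEmbedding.codAct
  RightActEmbedding.domNonempty

section Tensor

variable {S : Type u} [Monoid S]

/-- The pairs `((a s, b), (a, s b))`. -/
def tensorRel (S : Type u) [Monoid S] (A B : Type u) [MulAction Sᵐᵒᵖ A] [MulAction S B]
    (p q : A × B) : Prop :=
  ∃ (a : A) (s : S) (b : B), p = (a <• s, b) ∧ q = (a, s • b)

/-- The tensor product `A ⊗ B`: the quotient of `A × B` by the equivalence relation generated by
`tensorRel` (`Quot` is the quotient by the generated equivalence relation). -/
def Tensor (S : Type u) [Monoid S] (A B : Type u) [MulAction Sᵐᵒᵖ A] [MulAction S B] : Type u :=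
  Quot (tensorRel S A B)

/-- The map `f ⊗ I_B : A ⊗ B → A' ⊗ B`, `a ⊗ b ↦ f a ⊗ b`. -/
def tensorMap {A A' : Type u} [MulAction Sᵐᵒᵖ A] [MulAction Sᵐᵒᵖ A'] (f : A →[Sᵐᵒᵖ] A')
    (B : Type u) [MulAction S B] : Tensor S A B → Tensor S A' B :=
  Quot.map (fun p => (f p.1, p.2)) (by
    rintro _ _ ⟨a, s, b, rfl, rfl⟩
    exact ⟨f a, s, b, by simp, rfl⟩)

/-- `B` is `C`-flat: `- ⊗ B` maps each embedding in `C` to a one-one map. -/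
def CFlat (C : Set (RightActEmbedding S)) (B : Type u) [MulAction S B] : Prop :=
  ∀ e ∈ C, Function.Injective (tensorMap e.toHom B)

end Tensor

section Tossing

variable {S : Type u} [Monoid S]

/-- `(a, b)` and `(a', b')` are connected by a tossing over `A` and `B` with skeleton `σ`.
Here `x 0, x 1, …, x (n + 1)` are `a = a₁, a₂, …, aₘ, a'` and `y 0, …, y n` are `b₁, …, bₘ`. -/
def Connected (σ : Skeleton S) {A B : Type u} [MulAction Sᵐᵒᵖ A] [MulAction S B]
    (a : A) (b : B) (a' : A) (b' : B) : Prop :=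
  ∃ (x : Fin (σ.n + 2) → A) (y : Fin (σ.n + 1) → B),
    x 0 = a ∧ x (Fin.last _) = a' ∧
    (∀ i : Fin (σ.n + 1), x i.castSucc <• σ.s i = x i.succ <• σ.t i) ∧
    b = σ.s 0 • y 0 ∧
    (∀ i : Fin σ.n, σ.t i.castSucc • y i.castSucc = σ.s i.succ • y i.succ) ∧
    σ.t (Fin.last _) • y (Fin.last _) = b'

/-- The formula `δ_σ(a, a')` is true in the right `S`-act `A`: there are `a₂, …, aₘ` with
`a s₁ = a₂ t₁, a₂ s₂ = a₃ t₂, …, aₘ sₘ = a' tₘ`. -/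
def Delta (σ : Skeleton S) {A : Type u} [MulAction Sᵐᵒᵖ A] (a a' : A) : Prop :=
  ∃ x : Fin (σ.n + 2) → A, x 0 = a ∧ x (Fin.last _) = a' ∧
    ∀ i : Fin (σ.n + 1), x i.castSucc <• σ.s i = x i.succ <• σ.t i

/-- The embedding `τ : W → W'` and `w, w' ∈ W` are as Condition (Free) on `C` demands for the
skeleton `σ`. -/
structure IsFreeAt (C : Set (RightActEmbedding S)) (σ : Skeleton S) (τ : RightActEmbedding S)
    (w w' : τ.dom) : Prop where
  mem : τ ∈ C
  delta : Delta σ (τ.toHom w) (τ.toHom w')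
  lift : ∀ μ ∈ C, ∀ a a' : μ.dom, Delta σ (μ.toHom a) (μ.toHom a') →
    ∃ ν : τ.cod →[Sᵐᵒᵖ] μ.cod, ν (τ.toHom w) = μ.toHom a ∧ ν (τ.toHom w') = μ.toHom a' ∧
      ∀ z : τ.dom, ν (τ.toHom z) ∈ Set.range μ.toHom

end Tossing

section ModelTheory

/-- Function symbols of the language of left `S`-acts: one unary symbol for each `s : S`. -/
inductive ActFunc (S : Type u) : ℕ → Type u
  | smul (s : S) : ActFunc S 1

/-- The first order language `L_S` of left `S`-acts. -/
def actLanguage (S : Type u) : FirstOrder.Language.{u, 0} where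
  Functions := ActFunc S
  Relations := fun _ => Empty

/-- A class `K` of (nonempty) `L`-structures is axiomatisable: some set of sentences has exactly
the members of `K` as its models. -/
def Axiomatisable (L : FirstOrder.Language.{u, 0}) (K : ∀ (M : Type u) [L.Structure M], Prop) : Prop :=
  ∃ T : L.Theory, ∀ (M : Type u) [L.Structure M] [Nonempty M], K M ↔ M ⊨ T

/-- A class `K` of (nonempty) `L`-structures is closed under ultraproducts. -/
def ClosedUnderUltraproducts (L : FirstOrder.Language.{u, 0})
    (K : ∀ (M : Type u) [L.Structure M], Prop) : Prop :=
  ∀ (I : Type u) (U : Ultrafilter I) (M : I → Type u) [∀ i, L.Structure (M i)]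
    [∀ i, Nonempty (M i)], (∀ i, K (M i)) → K ((U : Filter I).Product M)

/-- The class of `C`-flat left `S`-acts, as a class of `L_S`-structures: the interpretation of the
function symbols is an action of `S`, and the resulting left `S`-act is `C`-flat. -/
def CFlatClass {S : Type u} [Monoid S] (C : Set (RightActEmbedding S))
    (M : Type u) [(actLanguage S).Structure M] : Prop :=
  ∃ _act : MulAction S M,
    (∀ (s : S) (x : M),
      FirstOrder.Language.Structure.funMap (L := actLanguage S) (ActFunc.smul s) ![x] = s • x) ∧
    CFlat C M

end ModelTheory

end SAct

namespace SAct

open scoped RightActions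
open FirstOrder FirstOrder.Language

/-! ### Tossings, tensor equality and transport along the universal embedding -/

section Tossings

variable {S : Type u} [Monoid S]

/-! A tossing splits into a condition `Delta` on the right act and a condition `Linked` on the left
act (`connected_iff`); for a fixed skeleton, `Linked` is first order in `L_S`. Equality in a tensor
product means that some skeleton works (`tensor_eq_iff`), an infinite disjunction, so
axiomatisability is a matter of bounding it by a finite one.

If no finite set of skeletons suffices for `σ`, take a counterexample for each finite set. Their
ultraproduct, flat by closure, yields a single skeleton `ρ`; Łoś's theorem pulls `ρ` back to a
counterexample whose finite set contains `ρ`, a contradiction. Conversely, finite bounds at the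
universal embeddings are sentences, and these force flatness at every member of `C`, because
Condition (Free) carries `Delta` from `W` to any domain (`IsFreeAt.transport`). -/

/-- The part of `Connected σ a b a' b'` that concerns the left `S`-act: there are `b₁, …, bₘ` with
`b = s₁ b₁, t₁ b₁ = s₂ b₂, …, tₘ bₘ = b'`. -/
def Linked (σ : Skeleton S) {B : Type u} [MulAction S B] (b b' : B) : Prop :=
  ∃ y : Fin (σ.n + 1) → B, b = σ.s 0 • y 0 ∧
    (∀ i : Fin σ.n, σ.t i.castSucc • y i.castSucc = σ.s i.succ • y i.succ) ∧
    σ.t (Fin.last _) • y (Fin.last _) = b'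

theorem connected_iff {σ : Skeleton S} {A B : Type u} [MulAction Sᵐᵒᵖ A] [MulAction S B]
    {a a' : A} {b b' : B} : Connected σ a b a' b' ↔ Delta σ a a' ∧ Linked σ b b' :=
  ⟨fun ⟨x, y, h0, h1, h2, h3, h4, h5⟩ => ⟨⟨x, h0, h1, h2⟩, ⟨y, h3, h4, h5⟩⟩,
    fun ⟨⟨x, h0, h1, h2⟩, ⟨y, h3, h4, h5⟩⟩ => ⟨x, y, h0, h1, h2, h3, h4, h5⟩⟩

theorem Delta.map {σ : Skeleton S} {A A' : Type u} [MulAction Sᵐᵒᵖ A] [MulAction Sᵐᵒᵖ A']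
    {a a' : A} (h : Delta σ a a') (f : A →[Sᵐᵒᵖ] A') : Delta σ (f a) (f a') := by
  obtain ⟨x, rfl, rfl, hx⟩ := h
  exact ⟨fun i => f (x i), rfl, rfl, fun i => by rw [← map_smul, hx, map_smul]⟩

/-- The skeleton `(s, t, s₁, t₁, …, sₘ, tₘ)`. -/
def Skeleton.cons (s t : S) (σ : Skeleton S) : Skeleton S where
  n := σ.n + 1
  s := Fin.cons s σ.s
  t := Fin.cons t σ.t

theorem Connected.cons {σ : Skeleton S} {A B : Type u} [MulAction Sᵐᵒᵖ A] [MulAction S B]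
    {a a₁ a' : A} {b' : B} {s t : S} {y₀ : B} (h : Connected σ a₁ (t • y₀) a' b')
    (ha : a <• s = a₁ <• t) : Connected (σ.cons s t) a (s • y₀) a' b' := by
  obtain ⟨x, y, h0, h1, h2, h3, h4, h5⟩ := h
  refine ⟨Fin.cons a x, Fin.cons y₀ y, rfl, h1, fun i => ?_, rfl, fun i => ?_, h5⟩
  · induction i using Fin.cases with
    | zero => exact ha.trans (congrArg (· <• t) h0.symm)
    | succ i => exact h2 i
  · induction i using Fin.cases with
    | zero => exact h3
    | succ i => exact h4 i

theorem tensor_mk_smul {A B : Type u} [MulAction Sᵐᵒᵖ A] [MulAction S B] (a : A) (s : S) (b : B) :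
    Quot.mk (tensorRel S A B) (a, s • b) = Quot.mk _ (a <• s, b) :=
  (Quot.sound ⟨a, s, b, rfl, rfl⟩).symm

theorem Connected.tensor_eq {σ : Skeleton S} {A B : Type u} [MulAction Sᵐᵒᵖ A] [MulAction S B]
    {a a' : A} {b b' : B} (h : Connected σ a b a' b') :
    Quot.mk (tensorRel S A B) (a, b) = Quot.mk _ (a', b') := by
  obtain ⟨x, y, rfl, rfl, h2, rfl, h4, rfl⟩ := h
  have key : ∀ i : Fin (σ.n + 1), Quot.mk (tensorRel S A B) (x 0, σ.s 0 • y 0) =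
      Quot.mk _ (x i.succ, σ.t i • y i) := by
    intro i
    induction i using Fin.induction with
    | zero =>
      rw [tensor_mk_smul, tensor_mk_smul, ← h2 0]
      rfl
    | succ i ih => rw [ih, h4, tensor_mk_smul, tensor_mk_smul, ← h2 i.succ, Fin.castSucc_succ]
  exact key (Fin.last _)

/-- Being connected to a fixed `(a', b')` is invariant under each generating pair, so tossings need
never be reversed or concatenated, only extended by one step at the front. -/
theorem exists_connected_of_tensor_eq {A B : Type u} [MulAction Sᵐᵒᵖ A] [MulAction S B]
    {a a' : A} {b b' : B}
    (h : Quot.mk (tensorRel S A B) (a, b) = Quot.mk _ (a', b')) :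
    ∃ σ : Skeleton S, Connected σ a b a' b' := by
  have hrel : ∀ p q : A × B, Relation.EqvGen (tensorRel S A B) p q →
      ((∃ σ : Skeleton S, Connected σ p.1 p.2 a' b') ↔
        ∃ σ : Skeleton S, Connected σ q.1 q.2 a' b') := by
    intro p q hpq
    induction hpq with
    | rel p q hpq =>
      obtain ⟨c, s, d, rfl, rfl⟩ := hpq
      constructor
      · rintro ⟨σ, hσ⟩
        -- The prepended pair is `(s, 1)` in this direction and `(1, s)` in the other.
        exact ⟨_, Connected.cons (s := s) (t := 1) (y₀ := d) (by simpa using hσ) (by simp)⟩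
      · rintro ⟨σ, hσ⟩
        have := Connected.cons (a := c <• s) (s := 1) (t := s) (y₀ := d) hσ (by simp)
        exact ⟨_, by simpa using this⟩
    | refl => rfl
    | symm _ _ _ ih => exact ih.symm
    | trans _ _ _ _ _ ih₁ ih₂ => exact ih₁.trans ih₂
  -- The skeleton `(1, 1)` connects `(a', b')` to itself.
  refine (hrel (a, b) (a', b') (Quot.eqvGen_exact h)).2
    ⟨⟨0, fun _ => 1, fun _ => 1⟩, fun _ => a', fun _ => b', rfl, rfl, fun _ => rfl, ?_,
      fun i => i.elim0, ?_⟩ <;> simp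

theorem tensor_eq_iff {A B : Type u} [MulAction Sᵐᵒᵖ A] [MulAction S B] {a a' : A} {b b' : B} :
    Quot.mk (tensorRel S A B) (a, b) = Quot.mk _ (a', b') ↔
      ∃ σ : Skeleton S, Connected σ a b a' b' :=
  ⟨exists_connected_of_tensor_eq, fun ⟨_, h⟩ => h.tensor_eq⟩

theorem cFlat_iff {C : Set (RightActEmbedding S)} {B : Type u} [MulAction S B] :
    CFlat C B ↔ ∀ γ ∈ C, ∀ (a a' : γ.dom) (b b' : B) (σ : Skeleton S),
      Connected σ (γ.toHom a) b (γ.toHom a') b' → ∃ ρ : Skeleton S, Connected ρ a b a' b' := by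
  refine forall₂_congr fun γ _ => ⟨fun h a a' b b' σ hσ => ?_, ?_⟩
  · exact exists_connected_of_tensor_eq
      (@h (Quot.mk _ (a, b)) (Quot.mk _ (a', b')) hσ.tensor_eq)
  · rintro h ⟨a, b⟩ ⟨a', b'⟩ hab
    obtain ⟨σ, hσ⟩ := exists_connected_of_tensor_eq hab
    exact tensor_eq_iff.2 (h a a' b b' σ hσ)

/-- A tossing over the domain of the universal embedding transports to every member of `C`. -/
theorem IsFreeAt.transport {C : Set (RightActEmbedding S)} {σ : Skeleton S}
    {τ : RightActEmbedding S} {w w' : τ.dom} (hτ : IsFreeAt C σ τ w w')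
    {γ : RightActEmbedding S} (hγ : γ ∈ C) {a a' : γ.dom}
    (hδ : Delta σ (γ.toHom a) (γ.toHom a')) {ρ : Skeleton S} (hρ : Delta ρ w w') :
    Delta ρ a a' := by
  obtain ⟨ν, h, h', hz⟩ := hτ.lift γ hγ a a' hδ
  -- Since `ν` maps the image of `W` into that of `γ`, and `γ` is injective, `ν` restricts to a
  -- morphism `W → A`.
  choose f hf using hz
  let g : τ.dom →[Sᵐᵒᵖ] γ.dom :=
    { toFun := f
      map_smul' := fun s z => γ.injective (by simp [hf]) }
  have hw : g w = a := γ.injective ((hf w).trans h)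
  have hw' : g w' = a' := γ.injective ((hf w').trans h')
  simpa [hw, hw'] using hρ.map g

/-- The `Linked` half of the given tossing is reused over `W'`, where `Delta σ` holds anyway; only
the `Delta` half of the result has to be transported. -/
theorem exists_finset_of_isFreeAt {C : Set (RightActEmbedding S)} {σ : Skeleton S}
    {τ : RightActEmbedding S} {w w' : τ.dom} (hτ : IsFreeAt C σ τ w w') {R : Finset (Skeleton S)}
    {B : Type u} [MulAction S B]
    (hR : ∀ b b' : B, Connected σ (τ.toHom w) b (τ.toHom w') b' → ∃ ρ ∈ R, Connected ρ w b w' b')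
    {γ : RightActEmbedding S} (hγ : γ ∈ C) {a a' : γ.dom} {b b' : B}
    (h : Connected σ (γ.toHom a) b (γ.toHom a') b') : ∃ ρ ∈ R, Connected ρ a b a' b' := by
  rw [connected_iff] at h
  obtain ⟨ρ, hρ, hc⟩ := hR b b' (connected_iff.2 ⟨hτ.delta, h.2⟩)
  rw [connected_iff] at hc
  exact ⟨ρ, hρ, connected_iff.2 ⟨hτ.transport hγ h.1 hc.1, hc.2⟩⟩

end Tossings

/-! ### First order expression of the left half of a tossing -/

section Formulas

variable {S : Type u}

/-- The term `s · t`. -/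
def smulTerm {α : Type} (s : S) (t : (actLanguage S).Term α) : (actLanguage S).Term α :=
  Functions.apply₁ (L := actLanguage S) (ActFunc.smul s) t

/-- The interpretation of the function symbols is the action of `S`. -/
def InterpretsAction (S : Type u) [Monoid S] (B : Type u) [MulAction S B]
    [(actLanguage S).Structure B] : Prop :=
  ∀ (s : S) (x : B), Structure.funMap (L := actLanguage S) (ActFunc.smul s) ![x] = s • x

/-- The structure for `actLanguage S` given by an action. -/
abbrev actStructure (S : Type u) [Monoid S] (B : Type u) [MulAction S B] :
    (actLanguage S).Structure B where
  funMap {_} f x := match f with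
    | ActFunc.smul s => s • x 0
  RelMap r := r.elim

/-- The formula that defines `Linked σ`. -/
noncomputable def linkedFormula (σ : Skeleton S) : (actLanguage S).Formula (Fin 2) :=
  Formula.iExs (Fin (σ.n + 1))
    ((Term.equal (.var (.inl 0)) (smulTerm (σ.s 0) (.var (.inr 0)))) ⊓
      (Formula.iInf fun i : Fin σ.n =>
        Term.equal (smulTerm (σ.t i.castSucc) (.var (.inr i.castSucc)))
          (smulTerm (σ.s i.succ) (.var (.inr i.succ)))) ⊓
      (Term.equal (smulTerm (σ.t (Fin.last _)) (.var (.inr (Fin.last _)))) (.var (.inl 1))))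

/-- The sentence saying that `Linked σ b b'` implies `Linked ρ b b'` for some `ρ ∈ R`. -/
noncomputable def linkedSentence (σ : Skeleton S) (R : Set (Skeleton S)) [Finite R] :
    (actLanguage S).Sentence :=
  Formula.iAlls (Fin 2) (((linkedFormula σ).imp
    (Formula.iSup fun ρ : R => linkedFormula ρ.1)).relabel Sum.inr)

/-- The sentence `∀ x, 1 · x = x`. -/
noncomputable def oneSentence (S : Type u) [Monoid S] : (actLanguage S).Sentence :=
  Formula.iAlls Unit (Term.equal (smulTerm 1 (.var (.inr ()))) (.var (.inr ())))

/-- The sentence `∀ x, (s t) · x = s · (t · x)`. -/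
noncomputable def mulSentence [Monoid S] (s t : S) : (actLanguage S).Sentence :=
  Formula.iAlls Unit (Term.equal (smulTerm (s * t) (.var (.inr ())))
    (smulTerm s (smulTerm t (.var (.inr ())))))

variable {B : Type u} [(actLanguage S).Structure B]

@[simp]
theorem realize_smulTerm {α : Type} (s : S) (t : (actLanguage S).Term α) (v : α → B) :
    (smulTerm s t).realize v =
      Structure.funMap (L := actLanguage S) (ActFunc.smul s) ![t.realize v] :=
  Term.realize_functions_apply₁

theorem realize_oneSentence [Monoid S] : B ⊨ oneSentence S ↔
    ∀ x : B, Structure.funMap (L := actLanguage S) (ActFunc.smul (1 : S)) ![x] = x := by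
  simp only [oneSentence, Sentence.Realize, Formula.realize_iAlls, Formula.realize_equal,
    realize_smulTerm, Term.realize_var, Sum.elim_inr]
  exact ⟨fun h x => h fun _ => x, fun h i => h (i ())⟩

theorem realize_mulSentence [Monoid S] (s t : S) : B ⊨ mulSentence s t ↔
    ∀ x : B, Structure.funMap (L := actLanguage S) (ActFunc.smul (s * t)) ![x] =
      Structure.funMap (L := actLanguage S) (ActFunc.smul s)
        ![Structure.funMap (L := actLanguage S) (ActFunc.smul t) ![x] ] := by
  simp only [mulSentence, Sentence.Realize, Formula.realize_iAlls, Formula.realize_equal,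
    realize_smulTerm, Term.realize_var, Sum.elim_inr]
  exact ⟨fun h x => h fun _ => x, fun h i => h (i ())⟩

variable [Monoid S] [MulAction S B]

theorem realize_linkedFormula (hB : InterpretsAction S B) (σ : Skeleton S) (v : Fin 2 → B) :
    (linkedFormula σ).Realize v ↔ Linked σ (v 0) (v 1) := by
  simp only [InterpretsAction] at hB
  simp [linkedFormula, Linked, hB, and_assoc]

theorem realize_linkedSentence (hB : InterpretsAction S B) (σ : Skeleton S) (R : Set (Skeleton S))
    [Finite R] : B ⊨ linkedSentence σ R ↔
      ∀ b b' : B, Linked σ b b' → ∃ ρ ∈ R, Linked ρ b b' := by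
  simp only [linkedSentence, Sentence.Realize, Formula.realize_iAlls, Formula.realize_relabel,
    Formula.realize_imp, Formula.realize_iSup, realize_linkedFormula hB]
  constructor
  · intro h b b' hb
    simpa using h ![b, b'] hb
  · intro h v hv
    simpa using h (v 0) (v 1) hv

end Formulas

/-! ### Ultraproducts and axioms for flat acts -/

section Classes

variable {S : Type u} [Monoid S] {C : Set (RightActEmbedding S)}

theorem cFlatClass_iff {M : Type u} [(actLanguage S).Structure M] :
    CFlatClass C M ↔ ∃ _ : MulAction S M, InterpretsAction S M ∧ CFlat C M :=
  Iff.rfl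

theorem Axiomatisable.closedUnderUltraproducts {L : FirstOrder.Language.{u, 0}}
    {K : ∀ (M : Type u) [L.Structure M], Prop} (h : Axiomatisable L K) :
    ClosedUnderUltraproducts L K := by
  obtain ⟨T, hT⟩ := h
  intro I U M _ _ hM
  rw [hT, Theory.model_iff]
  intro φ hφ
  rw [Ultraproduct.sentence_realize]
  exact .of_forall fun i => ((hT (M i)).1 (hM i)).realize_of_mem φ hφ

/-- If `C`-flat acts are closed under ultraproducts, finitely many skeletons are enough to witness
equality in `τ.dom ⊗ B` uniformly in the `C`-flat act `B`. -/
theorem exists_finset_of_closedUnderUltraproducts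
    (hU : ClosedUnderUltraproducts (actLanguage S) (fun M _ => CFlatClass C M))
    {τ : RightActEmbedding S} (hτ : τ ∈ C) (σ : Skeleton S) (w w' : τ.dom) :
    ∃ R : Finset (Skeleton S), ∀ (B : Type u) [MulAction S B] [Nonempty B], CFlat C B →
      ∀ b b' : B, Connected σ (τ.toHom w) b (τ.toHom w') b' →
        ∃ ρ ∈ R, Connected ρ w b w' b' := by
  classical
  by_contra! hcon
  choose B act ne flat b b' hσ hρ using hcon
  let : ∀ R, (actLanguage S).Structure (B R) := fun R => actStructure S (B R)
  have hB : ∀ R, InterpretsAction S (B R) := fun R s x => rfl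
  -- Refining `atTop` makes every set `{R | ρ ∈ R}` large.
  let U : Ultrafilter (Finset (Skeleton S)) := Ultrafilter.of Filter.atTop
  obtain ⟨actP, hP, flatP⟩ := cFlatClass_iff.1
    (hU _ U B fun R => cFlatClass_iff.2 ⟨act R, hB R, flat R⟩)
  let q : (∀ R, B R) → (U : Filter (Finset (Skeleton S))).Product B := fun f => f
  have los : ∀ ρ : Skeleton S, Linked ρ (q b) (q b') ↔ ∀ᶠ R in U, Linked ρ (b R) (b' R) := by
    intro ρ
    have h := Ultraproduct.realize_formula_cast (u := U) (linkedFormula ρ) ![b, b']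
    simp only [realize_linkedFormula (hB _)] at h
    exact (realize_linkedFormula hP ρ fun i => q (![b, b'] i)).symm.trans h
  -- `Delta` does not involve the left act, so any index would do.
  have hδ : Delta σ (τ.toHom w) (τ.toHom w') := (connected_iff.1 (hσ ∅)).1
  obtain ⟨ρ, h⟩ := cFlat_iff.1 flatP τ hτ w w' _ _ σ
    (connected_iff.2 ⟨hδ, (los σ).2 (.of_forall fun R => (connected_iff.1 (hσ R)).2)⟩)
  rw [connected_iff, los] at h
  have hmem : ∀ᶠ R in (U : Filter (Finset (Skeleton S))), ρ ∈ R :=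
    Ultrafilter.of_le Filter.atTop ((Filter.eventually_ge_atTop {ρ}).mono fun R hR =>
      Finset.singleton_subset_iff.1 hR)
  obtain ⟨R, hR, hR'⟩ := (h.2.and hmem).exists
  exact hρ R ρ hR' (connected_iff.2 ⟨h.1, hR⟩)

theorem axiomatisable_of_exists_finset (τ : Skeleton S → RightActEmbedding S)
    (w w' : ∀ σ : Skeleton S, (τ σ).dom) (hfree : ∀ σ, IsFreeAt C σ (τ σ) (w σ) (w' σ))
    (h : ∀ σ : Skeleton S, ∃ R : Finset (Skeleton S),
      ∀ (B : Type u) [MulAction S B] [Nonempty B], CFlat C B → ∀ b b' : B,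
        Connected σ ((τ σ).toHom (w σ)) b ((τ σ).toHom (w' σ)) b' →
          ∃ ρ ∈ R, Connected ρ (w σ) b (w' σ) b') :
    Axiomatisable (actLanguage S) (fun M _ => CFlatClass C M) := by
  choose R hR using h
  -- Axioms can speak only of the left act, so skeletons whose `Delta` half fails in `W` are
  -- discarded beforehand.
  let D : Skeleton S → Set (Skeleton S) := fun σ => {ρ ∈ R σ | Delta ρ (w σ) (w' σ)}
  have hD : ∀ σ, Finite (D σ) := fun σ => (R σ).finite_toSet.subset fun _ h => h.1
  refine ⟨{oneSentence S} ∪ Set.range (fun p : S × S => mulSentence p.1 p.2) ∪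
    Set.range fun σ => linkedSentence σ (D σ), fun M _ _ => ?_⟩
  simp only [Theory.model_iff, Set.mem_union, Set.mem_insert_iff,
    Set.singleton_union, or_imp, forall_and, forall_eq, Set.forall_mem_range, Prod.forall,
    realize_oneSentence, realize_mulSentence, cFlatClass_iff]
  constructor
  · rintro ⟨act, hM, flat⟩
    refine ⟨⟨fun x => ?_, fun s t x => ?_⟩, fun σ => ?_⟩
    · rw [hM, one_smul]
    · rw [hM, hM, hM, mul_smul]
    · rw [realize_linkedSentence hM]
      intro b b' hb
      obtain ⟨ρ, hρ, hc⟩ := hR σ M flat b b' (connected_iff.2 ⟨(hfree σ).delta, hb⟩)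
      rw [connected_iff] at hc
      exact ⟨ρ, ⟨hρ, hc.1⟩, hc.2⟩
  · rintro ⟨⟨h1, hmul⟩, hlink⟩
    let act : MulAction S M :=
      { smul := fun s x => Structure.funMap (L := actLanguage S) (ActFunc.smul s) ![x]
        one_smul := h1
        mul_smul := hmul }
    have hM : InterpretsAction S M := fun _ _ => rfl
    simp only [realize_linkedSentence hM] at hlink
    refine ⟨act, hM, cFlat_iff.2 fun γ hγ a a' b b' σ hσ => ?_⟩
    obtain ⟨ρ, -, hρ⟩ := exists_finset_of_isFreeAt (R := R σ) (hfree σ) (fun c c' hc => by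
      obtain ⟨ρ, hρ, hl⟩ := hlink σ c c' (connected_iff.1 hc).2
      exact ⟨ρ, hρ.1, connected_iff.2 ⟨hρ.2, hl⟩⟩) hγ hσ
    exact ⟨ρ, hρ⟩

end Classes

end SAct

theorem theorem3p6 {S : Type u} [Monoid S] (C : Set (SAct.RightActEmbedding S))
    (τ : SAct.Skeleton S → SAct.RightActEmbedding S)
    (w w' : ∀ σ : SAct.Skeleton S, (τ σ).dom)
    (hfree : ∀ σ : SAct.Skeleton S, SAct.IsFreeAt C σ (τ σ) (w σ) (w' σ)) :
    List.TFAE [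
      SAct.Axiomatisable (SAct.actLanguage S) (fun M _ => SAct.CFlatClass C M),
      SAct.ClosedUnderUltraproducts (SAct.actLanguage S) (fun M _ => SAct.CFlatClass C M),
      ∀ σ : SAct.Skeleton S, ∃ R : Finset (SAct.Skeleton S),
        ∀ γ ∈ C, ∀ (B : Type u) [MulAction S B] [Nonempty B], SAct.CFlat C B →
          ∀ (a a' : γ.dom) (b b' : B),
            SAct.Connected σ (γ.toHom a) b (γ.toHom a') b' →
              ∃ ρ ∈ R, SAct.Connected ρ a b a' b',
      ∀ σ : SAct.Skeleton S, ∃ R : Finset (SAct.Skeleton S),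
        ∀ (B : Type u) [MulAction S B] [Nonempty B], SAct.CFlat C B →
          ∀ b b' : B,
            SAct.Connected σ ((τ σ).toHom (w σ)) b ((τ σ).toHom (w' σ)) b' →
              ∃ ρ ∈ R, SAct.Connected ρ (w σ) b (w' σ) b'] := by
  tfae_have 1 → 2 := SAct.Axiomatisable.closedUnderUltraproducts
  tfae_have 2 → 4 := fun h σ =>
    SAct.exists_finset_of_closedUnderUltraproducts h (hfree σ).mem σ (w σ) (w' σ)
  tfae_have 4 → 3 := fun h σ =>
    (h σ).imp fun R hR γ hγ B _ _ hB a a' b b' hc =>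
      SAct.exists_finset_of_isFreeAt (hfree σ) (hR B hB) hγ hc
  tfae_have 3 → 4 := fun h σ =>
    (h σ).imp fun R hR B _ _ hB b b' => hR (τ σ) (hfree σ).mem B hB (w σ) (w' σ) b b'
  tfae_have 4 → 1 := SAct.axiomatisable_of_exists_finset τ w w' hfree
  tfae_finish
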